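/- Model. The cake is $[0,1]$. A cake-division instance with $n$ agents consists of subjective density functions $u_1,\dots,u_n$ and a market density function $v$, all non-negative and integrable on $[0,1]$; a density $f$ assigns to a Borel set (piece) $X\subseteq[0,1]$ the value $f(X)=\int_X f(x)\,dx$. An allocation is a tuple $A=(A_1,\dots,A_n)$ of Borel sets with $\bigcup_i A_i=[0,1]$ whose pairwise intersections have Lebesgue measure zero. $A$ is balanced if all $A_i$ have the same Lebesgue measure; envy-free (EF) w.r.t. the subjective utilities if $u_i(A_i)\ge u_i(A_j)$ for all $i,j$; EF w.r.t. the market valuation if $v(A_i)=v(A_j)$ for all $i,j$; and Pareto optimal (PO) w.r.t. the subjective utilities if there is no allocation $B$ with $u_i(B_i)\ge u_i(A_i)$ for all $i$ and strict inequality for some $i$. Theorem. There is a cake-division instance with $3$ agents whose subjective densities $u_1,u_2,u_3$ are strictly positive and continuous piecewise linear on $[0,1]$, with $u_i([0,1])=1$ for every $i$, and whose market density $v$ is uniform ($v(x)=1$ for all $x\in[0,1]$), such that no allocation is simultaneously balanced, EF and PO w.r.t. the subjective utilities. Consequently, in this instance no allocation is simultaneously EF and PO w.r.t. the subjective utilities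 and EF w.r.t. the market valuation; so the combination of these three properties cannot be guaranteed in general. -/

import Mathlib

open MeasureTheory

noncomputable section

namespace CakeCutting

/-- The cake, the interval `[0, 1]`. -/
def cake : Set ℝ := Set.Icc (0 : ℝ) 1

/-- A cake-division instance with `n` agents: subjective density functions and a market density
function on the cake (only the values on `[0, 1]` matter), all non-negative and integrable. -/
structure CakeInstance (n : ℕ) where
  /-- the subjective density function of each agent -/
  utility : Fin n → ℝ → ℝ
  /-- the market density function -/
  market : ℝ → ℝ
  utility_nonneg : ∀ i, ∀ x ∈ cake, 0 ≤ utility i x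
  utility_integrable : ∀ i, IntegrableOn (utility i) cake volume
  market_nonneg : ∀ x ∈ cake, 0 ≤ market x
  market_integrable : IntegrableOn market cake volume

/-- The value `f(X) = ∫_X f(x) dx` of a piece `X` under the density `f`. -/
def value (f : ℝ → ℝ) (X : Set ℝ) : ℝ := ∫ x in X, f x

/-- An allocation: Borel pieces that cover exactly the cake and
overlap pairwise in sets of Lebesgue measure zero only. -/
structure IsAllocation {n : ℕ} (A : Fin n → Set ℝ) : Prop where
  measurable : ∀ i, MeasurableSet (A i)
  overlap : ∀ i j, i ≠ j → volume (A i ∩ A j) = 0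
  cover : ⋃ i, A i = cake

/-- All pieces have the same length (Lebesgue measure). -/
def IsBalanced {n : ℕ} (A : Fin n → Set ℝ) : Prop :=
  ∀ i j, volume (A i) = volume (A j)

/-- Envy-freeness with respect to the subjective utilities. -/
def IsEF {n : ℕ} (I : CakeInstance n) (A : Fin n → Set ℝ) : Prop :=
  ∀ i j, value (I.utility i) (A j) ≤ value (I.utility i) (A i)

/-- Envy-freeness with respect to the market valuation. -/
def IsMarketEF {n : ℕ} (I : CakeInstance n) (A : Fin n → Set ℝ) : Prop :=
  ∀ i j, value I.market (A i) = value I.market (A j)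

/-- Pareto optimality with respect to the subjective utilities: no allocation is
at least as good for every agent and strictly better for some agent. -/
def IsPO {n : ℕ} (I : CakeInstance n) (A : Fin n → Set ℝ) : Prop :=
  ¬ ∃ B : Fin n → Set ℝ, IsAllocation B ∧
    (∀ i, value (I.utility i) (A i) ≤ value (I.utility i) (B i)) ∧
    ∃ i, value (I.utility i) (A i) < value (I.utility i) (B i)

/-- `f` is (continuous) piecewise linear on the cake: there are breakpoints
`0 = t 0 < t 1 < ⋯ < t k = 1` such that `f` is affine on each `[t i, t (i + 1)]`. -/
def IsPiecewiseLinear (f : ℝ → ℝ) : Prop :=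
  ∃ (k : ℕ) (t : Fin (k + 1) → ℝ), StrictMono t ∧ t 0 = 0 ∧ t (Fin.last k) = 1 ∧
    ∀ i : Fin k, ∃ a b : ℝ, ∀ x ∈ Set.Icc (t i.castSucc) (t i.succ), f x = a * x + b

end CakeCutting

end

open MeasureTheory

namespace CakeCutting

/-! All three densities are affine with total value 1, of slopes 1/2, 1 and 3/2, so Pareto
optimality pushes the flattest agent 0 to the left. Were `A 0` of length 1/3 essentially inside [0,
1/3], agent 0 would value it below 1/3, against envy-freeness. So `A 0` has mass right of 1/3
(`IsAllocation.volume_inter_Ioi_ne_zero`), and some other agent `j` has mass left of 1/3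
(`IsAllocation.exists_volume_inter_Iic_ne_zero`). Agent 0 trades part of the former for part of the
latter at equal value to itself. Agent `j`, being steeper, strictly gains
(`value_lt_value_of_slope_lt`), so the allocation is not Pareto optimal (`not_isPO_of_exchange`). -/

lemma IsAllocation.subset_cake {n : ℕ} {A : Fin n → Set ℝ} (hA : IsAllocation A) (i : Fin n) :
    A i ⊆ cake :=
  hA.cover ▸ Set.subset_iUnion A i

lemma IsAllocation.sum_value {n : ℕ} {A : Fin n → Set ℝ} (hA : IsAllocation A) {f : ℝ → ℝ}
    (hf : IntegrableOn f cake) : ∑ i, value f (A i) = value f cake := by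
  have h := integral_iUnion_ae (μ := volume) (f := f) (s := A)
    (fun i => (hA.measurable i).nullMeasurableSet) (fun i j hij => hA.overlap i j hij)
    (by rwa [hA.cover])
  rw [hA.cover, tsum_fintype] at h
  exact h.symm

/-! ### Exchanges and Pareto optimality -/

/-- A trade between two agents that does not hurt the first one and strictly benefits the
second one rules out Pareto optimality. -/
lemma not_isPO_of_exchange {n : ℕ} {I : CakeInstance n} {A : Fin n → Set ℝ}
    (hA : IsAllocation A) {i j : Fin n} (hij : i ≠ j) {E F : Set ℝ}
    (hE : MeasurableSet E) (hF : MeasurableSet F)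
    (hEA : E ⊆ A i \ A j) (hFA : F ⊆ A j \ A i)
    (hi : value (I.utility i) E ≤ value (I.utility i) F)
    (hj : value (I.utility j) F < value (I.utility j) E) : ¬ IsPO I A := by
  have key : ∀ (a : Fin n) (X P Q : Set ℝ), X ⊆ cake → MeasurableSet P → MeasurableSet Q →
      P ⊆ X → Q ⊆ cake → Disjoint X Q →
      value (I.utility a) ((X \ P) ∪ Q) =
        value (I.utility a) X - value (I.utility a) P + value (I.utility a) Q := by
    intro a X P Q hX hP hQ hPX hQc hXQ
    have hint := I.utility_integrable a
    unfold value
    rw [setIntegral_union (hXQ.mono_left Set.sdiff_subset) hQ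
      (hint.mono_set (Set.sdiff_subset.trans hX)) (hint.mono_set hQc),
      setIntegral_sdiff₀ hP.nullMeasurableSet (hint.mono_set hX) hPX]
  have hEi : E ⊆ A i := fun x hx => (hEA hx).1
  have hFj : F ⊆ A j := fun x hx => (hFA hx).1
  have hEj : Disjoint (A j) E := Set.disjoint_right.2 fun x hx => (hEA hx).2
  have hFi : Disjoint (A i) F := Set.disjoint_right.2 fun x hx => (hFA hx).2
  let B : Fin n → Set ℝ := fun k =>
    if k = i then (A i \ E) ∪ F else if k = j then (A j \ F) ∪ E else A k
  have hBi : B i = (A i \ E) ∪ F := by simp [B]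
  have hBj : B j = (A j \ F) ∪ E := by simp [B, hij.symm]
  have hBk : ∀ k, k ≠ i → k ≠ j → B k = A k := fun k h1 h2 => by simp [B, h1, h2]
  have hvi := key i (A i) E F (hA.subset_cake i) hE hF hEi (hFj.trans (hA.subset_cake j)) hFi
  have hvj := key j (A j) F E (hA.subset_cake j) hF hE hFj (hEi.trans (hA.subset_cake i)) hEj
  rw [← hBi] at hvi
  rw [← hBj] at hvj
  -- Only `E` and `F` move, so overlaps with a third piece stay inside overlaps of the original
  -- pieces.
  have hBsub : ∀ k, B k ⊆ A k ∪ (E ∪ F) := by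
    intro k x hx
    simp only [B] at hx
    split_ifs at hx <;> grind
  have hnull : ∀ k l, k ≠ l → volume (B k ∩ B l) = 0 := by
    have h1 : volume (B i ∩ B j) = 0 := by
      refine measure_mono_null ?_ (hA.overlap i j hij)
      rw [hBi, hBj]
      rintro x ⟨hx | hx, hy | hy⟩
      · exact ⟨hx.1, hy.1⟩
      · exact absurd hy hx.2
      · exact absurd hx hy.2
      · exact absurd (hEi hy) (hFA hx).2
    have h2 : ∀ k l, l ≠ i → l ≠ j → k ≠ l → volume (B k ∩ B l) = 0 := by
      intro k l hli hlj hkl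
      rw [hBk l hli hlj]
      refine measure_mono_null (t := (A k ∩ A l) ∪ ((A i ∩ A l) ∪ (A j ∩ A l))) ?_
        (measure_union_null (hA.overlap k l hkl)
          (measure_union_null (hA.overlap i l hli.symm) (hA.overlap j l hlj.symm)))
      rintro x ⟨hx, hy⟩
      rcases hBsub k hx with h | h | h
      · exact Or.inl ⟨h, hy⟩
      · exact Or.inr (Or.inl ⟨hEi h, hy⟩)
      · exact Or.inr (Or.inr ⟨hFj h, hy⟩)
    intro k l hkl
    by_cases hl : l = i ∨ l = j
    · by_cases hk : k = i ∨ k = j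
      · rcases hl with rfl | rfl <;> rcases hk with rfl | rfl
        · exact absurd rfl hkl
        · rwa [Set.inter_comm]
        · exact h1
        · exact absurd rfl hkl
      · push Not at hk
        rw [Set.inter_comm]
        exact h2 l k hk.1 hk.2 hkl.symm
    · push Not at hl
      exact h2 k l hl.1 hl.2 hkl
  refine fun hPO => hPO ⟨B, ⟨?_, hnull, ?_⟩, ?_, j, by linarith⟩
  · intro k
    have := hA.measurable
    simp only [B]
    split_ifs
    · exact ((this i).diff hE).union hF
    · exact ((this j).diff hF).union hE
    · exact this k
  · refine (Set.iUnion_subset fun k => (hBsub k).trans ?_).antisymm ?_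
    · exact Set.union_subset (hA.subset_cake k) (Set.union_subset
        (hEi.trans (hA.subset_cake i)) (hFj.trans (hA.subset_cake j)))
    · rw [← hA.cover]
      refine Set.iUnion_subset fun k x hx => Set.mem_iUnion.2 ?_
      by_cases hxE : x ∈ E
      · exact ⟨j, hBj ▸ Or.inr hxE⟩
      by_cases hxF : x ∈ F
      · exact ⟨i, hBi ▸ Or.inr hxF⟩
      refine ⟨k, ?_⟩
      simp only [B]
      split_ifs <;> grind
  · intro k
    by_cases hki : k = i
    · subst hki; linarith
    by_cases hkj : k = j
    · subst hkj; linarith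
    · rw [hBk k hki hkj]

/-! ### Pieces of prescribed value -/

lemma setIntegral_pos_of_pos_on {f : ℝ → ℝ} {S : Set ℝ} (hS : MeasurableSet S)
    (hf : IntegrableOn f S) (hpos : ∀ x ∈ S, 0 < f x) (hvol : volume S ≠ 0) :
    0 < ∫ x in S, f x := by
  rw [setIntegral_pos_iff_support_of_nonneg_ae
    ((ae_restrict_iff' hS).2 (.of_forall fun x hx => (hpos x hx).le)) hf,
    Set.inter_eq_right.2 (show S ⊆ Function.support f from fun x hx => (hpos x hx).ne')]
  exact pos_iff_ne_zero.2 hvol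

/-- Every value between `0` and that of a given piece is the value of some part of it. -/
lemma exists_subset_value_eq {f : ℝ → ℝ} {S : Set ℝ} (hS : MeasurableSet S) (hSc : S ⊆ cake)
    (hf : IntegrableOn f cake) {c : ℝ} (h0 : 0 ≤ c) (hc : c ≤ value f S) :
    ∃ E ⊆ S, MeasurableSet E ∧ value f E = c := by
  have hint : Integrable (S.indicator f) :=
    (integrable_indicator_iff hS).2 (hf.mono_set hSc)
  have heq : ∀ t, 0 ≤ t → (∫ x in (0 : ℝ)..t, S.indicator f x) = value f (Set.Ioc 0 t ∩ S) := by
    intro t ht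
    rw [intervalIntegral.integral_of_le ht, setIntegral_indicator hS, value]
  have hfull : value f (Set.Ioc 0 1 ∩ S) = value f S := by
    refine setIntegral_congr_set ?_
    have h : (Set.Ioc (0 : ℝ) 1 ∩ S : Set ℝ) =ᵐ[volume] (Set.Icc (0 : ℝ) 1 ∩ S : Set ℝ) :=
      Ioc_ae_eq_Icc.inter (Filter.EventuallyEq.refl _ S)
    rwa [Set.inter_eq_right.2 (show S ⊆ Set.Icc (0 : ℝ) 1 from hSc)] at h
  -- The part is cut off by a moving knife: the value left of `t` is continuous in `t`, so it takes
  -- the value `c`.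
  have hcont : Continuous fun t => ∫ x in (0 : ℝ)..t, S.indicator f x :=
    intervalIntegral.continuous_primitive (fun _ _ => hint.intervalIntegrable) 0
  obtain ⟨t, ht, htc⟩ := intermediate_value_Icc (zero_le_one (α := ℝ)) hcont.continuousOn
    (show c ∈ _ by
      constructor
      · simpa using h0
      · simpa only [heq 1 zero_le_one, hfull] using hc)
  exact ⟨Set.Ioc 0 t ∩ S, Set.inter_subset_right, measurableSet_Ioc.inter hS, by
    rw [← heq t ht.1]; exact htc⟩

/-! ### Affine densities and the instance -/

/-- The affine density of slope `a` that integrates to `1` over the cake. -/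
noncomputable def affineDensity (a x : ℝ) : ℝ := 1 + a * (x - 1 / 2)

lemma affineDensity_pos {a x : ℝ} (ha : 0 ≤ a) (ha' : a < 2) (hx : x ∈ cake) :
    0 < affineDensity a x := by
  obtain ⟨h0, h1⟩ := hx
  unfold affineDensity
  nlinarith [mul_nonneg ha h0]

lemma integrableOn_affineDensity (a : ℝ) : IntegrableOn (affineDensity a) cake := by
  refine ContinuousOn.integrableOn_compact isCompact_Icc (Continuous.continuousOn ?_)
  unfold affineDensity
  fun_prop

lemma value_affineDensity_cake (a : ℝ) : value (affineDensity a) cake = 1 := by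
  unfold value cake
  rw [integral_Icc_eq_integral_Ioc, ← intervalIntegral.integral_of_le zero_le_one]
  have h : ∀ x ∈ Set.uIcc (0 : ℝ) 1,
      HasDerivAt (fun x : ℝ => x + a * (x ^ 2 / 2 - x / 2)) (affineDensity a x) x := by
    intro x _
    have h2 : HasDerivAt (fun x : ℝ => x ^ 2 / 2 - x / 2) (x - 1 / 2) x := by
      have h3 := ((hasDerivAt_pow 2 x).div_const 2).sub ((hasDerivAt_id' x).div_const 2)
      convert! h3 using 1
      norm_num
    exact (hasDerivAt_id' x).add (h2.const_mul a)
  have hc : Continuous (affineDensity a) := by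
    unfold affineDensity
    fun_prop
  rw [intervalIntegral.integral_eq_sub_of_hasDerivAt h (hc.intervalIntegrable _ _)]
  norm_num

lemma isPiecewiseLinear_affineDensity (a : ℝ) : IsPiecewiseLinear (affineDensity a) := by
  refine ⟨1, ![0, 1], ?_, rfl, rfl, fun i => ⟨a, 1 - a / 2, fun x _ => ?_⟩⟩
  · intro i j hij
    fin_cases i <;> fin_cases j <;> simp_all
  · unfold affineDensity
    ring

/-- If a piece to the right of `1 / 3` and one to the left of it have the same value under
a density of slope `a`, then a steeper density prefers the right one. -/
lemma value_lt_value_of_slope_lt {a b : ℝ} (hab : a < b) (hb : b < 2) {E F : Set ℝ}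
    (hE : MeasurableSet E) (hF : MeasurableSet F) (hEc : E ⊆ cake) (hFc : F ⊆ cake)
    (hE3 : E ⊆ Set.Ioi (1 / 3)) (hF3 : F ⊆ Set.Iic (1 / 3)) (hE0 : volume E ≠ 0)
    (hEF : value (affineDensity a) E = value (affineDensity a) F) :
    value (affineDensity b) F < value (affineDensity b) E := by
  -- The coefficients `1 - a / 6` and `1 - b / 6` are the two densities at 1/3, chosen so that the
  -- combination vanishes there. It is positive to the right of 1/3 and negative to the left.
  have hcomb : ∀ x, (1 - a / 6) * affineDensity b x - (1 - b / 6) * affineDensity a x =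
      (b - a) * (x - 1 / 3) := by
    intro x
    unfold affineDensity
    ring
  have hi : ∀ c X, X ⊆ cake → ∀ k, IntegrableOn (fun x => k * affineDensity c x) X :=
    fun c X hX k => ((integrableOn_affineDensity c).mono_set hX).const_mul k
  have hsub : ∀ X, X ⊆ cake → ∫ x in X, (b - a) * (x - 1 / 3) =
      (1 - a / 6) * value (affineDensity b) X - (1 - b / 6) * value (affineDensity a) X := by
    intro X hX
    simp_rw [← hcomb]
    rw [integral_sub (hi b X hX _) (hi a X hX _), integral_const_mul, integral_const_mul]
    rfl
  have hpos : 0 < ∫ x in E, (b - a) * (x - 1 / 3) := by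
    refine setIntegral_pos_of_pos_on hE ?_ (fun x hx => ?_) hE0
    · simp_rw [← hcomb]
      exact (hi b E hEc _).sub (hi a E hEc _)
    · exact mul_pos (by linarith) (sub_pos.2 (hE3 hx))
  have hneg : ∫ x in F, (b - a) * (x - 1 / 3) ≤ 0 :=
    setIntegral_nonpos hF fun x hx =>
      mul_nonpos_of_nonneg_of_nonpos (by linarith) (sub_nonpos.2 (hF3 hx))
  rw [hsub E hEc, hEF] at hpos
  rw [hsub F hFc] at hneg
  exact lt_of_mul_lt_mul_left (by linarith) (show (0 : ℝ) ≤ 1 - a / 6 by linarith)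

/-- Three agents with affine densities of slopes `1 / 2`, `1` and `3 / 2`, under the uniform
market density. -/
noncomputable def affineInstance : CakeInstance 3 where
  utility i := affineDensity (((i : ℕ) + 1) / 2)
  market _ := 1
  utility_nonneg i x hx := by
    refine (affineDensity_pos (by positivity) ?_ hx).le
    have : ((i : ℕ) : ℝ) ≤ 2 := by exact_mod_cast Nat.lt_succ_iff.1 i.2
    linarith
  utility_integrable i := integrableOn_affineDensity _
  market_nonneg _ _ := zero_le_one
  market_integrable := integrableOn_const (by simp [cake])

lemma slope_lt_two (i : Fin 3) : (((i : ℕ) : ℝ) + 1) / 2 < 2 := by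
  have : ((i : ℕ) : ℝ) ≤ 2 := by exact_mod_cast Nat.lt_succ_iff.1 i.2
  linarith

/-! ### Balanced envy-free allocations of the instance -/

lemma IsAllocation.volume_eq_third {A : Fin 3 → Set ℝ} (hA : IsAllocation A)
    (hbal : IsBalanced A) (i : Fin 3) : volume (A i) = ENNReal.ofReal (1 / 3) := by
  have hsum := hA.sum_value (f := fun _ => 1) (integrableOn_const (by simp [cake]))
  have hcake : (volume cake).toReal = 1 := by simp [cake]
  simp only [value, setIntegral_const, smul_eq_mul, mul_one, hcake, Measure.real, hbal _ i,
    Finset.sum_const, Finset.card_univ, Fintype.card_fin, nsmul_eq_mul] at hsum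
  have hfin : volume (A i) ≠ ⊤ :=
    ((measure_mono (hA.subset_cake i)).trans_lt (by simp [cake])).ne
  rw [← ENNReal.ofReal_toReal hfin]
  congr 1
  push_cast at hsum
  linarith

/-- Envy-freeness gives agent 0 at least 1/3 of its total value, but a piece of length 1/3 lying
left of 1/3 is worth at most 11/36 to it. -/
lemma IsAllocation.volume_inter_Ioi_ne_zero {A : Fin 3 → Set ℝ} (hA : IsAllocation A)
    (hbal : IsBalanced A) (hEF : IsEF affineInstance A) :
    volume (A 0 ∩ Set.Ioi (1 / 3)) ≠ 0 := by
  intro hnull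
  have hge : 1 / 3 ≤ value (affineInstance.utility 0) (A 0) := by
    have hsum := hA.sum_value (affineInstance.utility_integrable 0)
    have h1 : value (affineInstance.utility 0) cake = 1 := value_affineDensity_cake _
    rw [h1, Fin.sum_univ_three] at hsum
    linarith [hEF 0 1, hEF 0 2]
  -- 11/12 is the density of agent 0 at 1/3, hence its maximum on [0, 1/3].
  have hle : value (affineInstance.utility 0) (A 0) ≤ ∫ _ in A 0, (11 / 12 : ℝ) := by
    refine setIntegral_mono_ae_restrict
      ((affineInstance.utility_integrable 0).mono_set (hA.subset_cake 0))
      (integrableOn_const (by rw [hA.volume_eq_third hbal]; exact ENNReal.ofReal_ne_top)) ?_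
    refine (ae_restrict_iff' (hA.measurable 0)).2 ?_
    filter_upwards [measure_eq_zero_iff_ae_notMem.1 hnull] with x hx hx0
    have hx3 : x ≤ 1 / 3 := not_lt.1 fun h => hx ⟨hx0, h⟩
    simp only [affineInstance, affineDensity, Fin.val_zero, Nat.cast_zero]
    linarith
  rw [setIntegral_const, Measure.real, hA.volume_eq_third hbal,
    ENNReal.toReal_ofReal (by norm_num), smul_eq_mul] at hle
  linarith

/-- Otherwise `A 0` would contain almost all of [0, 1/3], which already uses up its length 1/3 and
leaves nothing to the right. -/
lemma IsAllocation.exists_volume_inter_Iic_ne_zero {A : Fin 3 → Set ℝ} (hA : IsAllocation A)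
    (hbal : IsBalanced A) (h0 : volume (A 0 ∩ Set.Ioi (1 / 3)) ≠ 0) :
    ∃ j, j ≠ 0 ∧ volume (A j ∩ Set.Iic (1 / 3)) ≠ 0 := by
  by_contra! hnull
  refine h0 ?_
  have hcover : Set.Icc (0 : ℝ) (1 / 3) ⊆ (A 0 ∩ Set.Iic (1 / 3)) ∪
      ((A 1 ∩ Set.Iic (1 / 3)) ∪ (A 2 ∩ Set.Iic (1 / 3))) := by
    intro x hx
    have hxc : x ∈ ⋃ i, A i := hA.cover ▸ ⟨hx.1, hx.2.trans (by norm_num)⟩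
    obtain ⟨i, hi⟩ := Set.mem_iUnion.1 hxc
    fin_cases i
    · exact Or.inl ⟨hi, hx.2⟩
    · exact Or.inr (Or.inl ⟨hi, hx.2⟩)
    · exact Or.inr (Or.inr ⟨hi, hx.2⟩)
  have hge : ENNReal.ofReal (1 / 3) ≤ volume (A 0 ∩ Set.Iic (1 / 3)) := by
    have h := (measure_mono (μ := volume) hcover).trans (measure_union_le _ _)
    rw [measure_union_null (hnull 1 (by decide)) (hnull 2 (by decide)), add_zero,
      Real.volume_Icc, sub_zero] at h
    exact h
  have hsplit := measure_inter_add_sdiff (μ := volume) (A 0) (measurableSet_Iic (a := (1 / 3 : ℝ)))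
  rw [Set.sdiff_eq, Set.compl_Iic, hA.volume_eq_third hbal] at hsplit
  have hle : ENNReal.ofReal (1 / 3) + volume (A 0 ∩ Set.Ioi (1 / 3)) ≤
      ENNReal.ofReal (1 / 3) + 0 := by
    rw [add_zero]
    exact (add_le_add_left hge _).trans hsplit.le
  exact nonpos_iff_eq_zero.1 ((ENNReal.add_le_add_iff_left ENNReal.ofReal_ne_top).1 hle)

lemma not_isPO_affineInstance {A : Fin 3 → Set ℝ} (hA : IsAllocation A)
    (hbal : IsBalanced A) (hEF : IsEF affineInstance A) : ¬ IsPO affineInstance A := by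
  have h0 := hA.volume_inter_Ioi_ne_zero hbal hEF
  obtain ⟨j, hj0, hj⟩ := hA.exists_volume_inter_Iic_ne_zero hbal h0
  set u := affineInstance.utility 0 with hu
  have hui : IntegrableOn u cake := affineInstance.utility_integrable 0
  -- The null overlap is removed because the exchange needs parts owned by one of the two agents
  -- only.
  have hpos : ∀ k l : Fin 3, k ≠ l → ∀ Z : Set ℝ, MeasurableSet Z → volume (A k ∩ Z) ≠ 0 →
      0 < value u ((A k ∩ Z) \ A l) := by
    intro k l hkl Z hZ hv
    have hsub : (A k ∩ Z) \ A l ⊆ cake := fun x hx => hA.subset_cake k hx.1.1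
    refine setIntegral_pos_of_pos_on (((hA.measurable k).inter hZ).diff (hA.measurable l))
      (hui.mono_set hsub) (fun x hx => affineDensity_pos (by positivity) (slope_lt_two 0)
        (hsub hx)) ?_
    have hnull : volume ((A k ∩ Z) ∩ A l) = 0 :=
      measure_mono_null (Set.inter_subset_inter_left _ Set.inter_subset_left) (hA.overlap k l hkl)
    rwa [measure_sdiff_null' hnull]
  have hEpos := hpos 0 j hj0.symm _ measurableSet_Ioi h0
  have hFpos := hpos j 0 hj0 _ measurableSet_Iic hj
  -- Both traded parts are cut to the smaller of the two values to agent 0. As it is positive, `E`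
  -- is not null, which makes the gain of `j` strict.
  have hc := lt_min hEpos hFpos
  obtain ⟨E, hES, hE, hEc⟩ := exists_subset_value_eq
    (((hA.measurable 0).inter measurableSet_Ioi).diff (hA.measurable j))
    (fun x hx => hA.subset_cake 0 hx.1.1) hui hc.le (min_le_left _ _)
  obtain ⟨F, hFS, hF, hFc⟩ := exists_subset_value_eq
    (((hA.measurable j).inter measurableSet_Iic).diff (hA.measurable 0))
    (fun x hx => hA.subset_cake j hx.1.1) hui hc.le (min_le_right _ _)
  have hE0 : volume E ≠ 0 := by
    intro h
    rw [← hEc, value, setIntegral_measure_zero _ h] at hc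
    exact lt_irrefl _ hc
  have hslope : (((0 : Fin 3) : ℕ) + 1 : ℝ) / 2 < ((j : ℕ) + 1 : ℝ) / 2 := by
    have : (0 : ℝ) < ((j : ℕ) : ℝ) := by
      exact_mod_cast Nat.pos_of_ne_zero fun h => hj0 (Fin.ext h)
    simp only [Fin.val_zero, Nat.cast_zero]
    linarith
  refine not_isPO_of_exchange hA hj0.symm hE hF
    (fun x hx => ⟨(hES hx).1.1, (hES hx).2⟩) (fun x hx => ⟨(hFS hx).1.1, (hFS hx).2⟩)
    (hEc.trans hFc.symm).le ?_
  exact value_lt_value_of_slope_lt hslope (slope_lt_two j) hE hF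
    (fun x hx => hA.subset_cake 0 (hES hx).1.1) (fun x hx => hA.subset_cake j (hFS hx).1.1)
    (fun x hx => (hES hx).1.2) (fun x hx => (hFS hx).1.2) hE0 (hEc.trans hFc.symm)

/-- Under the uniform market density, market envy-freeness forces balancedness. -/
lemma IsMarketEF.isBalanced {A : Fin 3 → Set ℝ} (h : IsMarketEF affineInstance A)
    (hA : IsAllocation A) : IsBalanced A := by
  intro i j
  have hfin : ∀ k, volume (A k) ≠ ⊤ := fun k =>
    ((measure_mono (hA.subset_cake k)).trans_lt (by simp [cake])).ne
  have hij := h i j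
  simp only [value, affineInstance, setIntegral_const, smul_eq_mul, mul_one] at hij
  exact (ENNReal.toReal_eq_toReal_iff' (hfin i) (hfin j)).1 hij

end CakeCutting

theorem mainTheorem11 :
    ∃ I : CakeCutting.CakeInstance 3,
      (∀ i, ∀ x ∈ CakeCutting.cake, 0 < I.utility i x) ∧
      (∀ i, CakeCutting.IsPiecewiseLinear (I.utility i)) ∧
      (∀ i, CakeCutting.value (I.utility i) CakeCutting.cake = 1) ∧
      (∀ x ∈ CakeCutting.cake, I.market x = 1) ∧
      (¬ ∃ A : Fin 3 → Set ℝ, CakeCutting.IsAllocation A ∧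
        CakeCutting.IsBalanced A ∧ CakeCutting.IsEF I A ∧ CakeCutting.IsPO I A) ∧
      (¬ ∃ A : Fin 3 → Set ℝ, CakeCutting.IsAllocation A ∧
        CakeCutting.IsEF I A ∧ CakeCutting.IsPO I A ∧ CakeCutting.IsMarketEF I A) := by

  refine ⟨CakeCutting.affineInstance, fun i x hx => ?_,
    fun i => CakeCutting.isPiecewiseLinear_affineDensity _,
    fun i => CakeCutting.value_affineDensity_cake _, fun _ _ => rfl, ?_, ?_⟩
  · exact CakeCutting.affineDensity_pos (by positivity) (CakeCutting.slope_lt_two i) hx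
  · rintro ⟨A, hA, hbal, hEF, hPO⟩
    exact CakeCutting.not_isPO_affineInstance hA hbal hEF hPO
  · rintro ⟨A, hA, hEF, hPO, hM⟩
    exact CakeCutting.not_isPO_affineInstance hA (hM.isBalanced hA) hEF hPO
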